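/- Let $\mathbb{C}^\infty=\bigcup_n\mathbb{C}^n$ carry the colimit topology, and let $BU(1)=\mathbb{P}^\infty=(\mathbb{C}^\infty\setminus\{0\})/\mathbb{C}^\times$ with the quotient topology, i.e. the space of complex lines in $\mathbb{C}^\infty$. Let $$V_1=\{(\ell,v)\in BU(1)\times\mathbb{C}^\infty : v\in\ell\}\to BU(1)$$ be the tautological complex line bundle, with the Hermitian metric induced by the standard one on $\mathbb{C}^\infty$, and let $BU(1)^{V_1}=D(V_1)/S(V_1)$ be its Thom space, the quotient of the unit disc bundle obtained by collapsing the unit sphere bundle to a point. Then the zero section $$\iota\colon BU(1)\to BU(1)^{V_1},\qquad \ell\mapsto[(\ell,0)],$$ is a homotopy equivalence. -/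

import Mathlib

open scoped LinearAlgebra.Projectivization ContinuousMap

noncomputable section

/-! ## The Thom space of a vector bundle with a fibrewise norm -/

section Thom

variable {E : Type*} [TopologicalSpace E]

/-- The unit disc bundle `D(E)` of a bundle with total space `E` and fibrewise norm `ν`. -/
def DiscBundle (ν : E → ℝ) : Type _ := {v : E // ν v ≤ 1}

instance (ν : E → ℝ) : TopologicalSpace (DiscBundle ν) :=
  inferInstanceAs (TopologicalSpace {v : E // ν v ≤ 1})

/-- The relation gluing every vector of the unit sphere bundle `S(E) ⊆ D(E)` to one extra point. -/
inductive ThomRel (ν : E → ℝ) : DiscBundle ν ⊕ PUnit.{1} → DiscBundle ν ⊕ PUnit.{1} → Prop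
  | glue (v : DiscBundle ν) (hv : ν v.1 = 1) : ThomRel ν (Sum.inl v) (Sum.inr PUnit.unit)

/-- The Thom space `D(E) / S(E)` of a bundle with total space `E` and fibrewise norm `ν`, as the
pushout of `D(E) ← S(E) → pt` with its quotient topology. (The extra point is the base point; it
only matters separately from `D(E)` when `S(E)` is empty, where `D(E) / ∅` is `D(E)` with a disjoint
base point.) -/
def ThomSpace (ν : E → ℝ) : Type _ := Quot (ThomRel ν)

instance (ν : E → ℝ) : TopologicalSpace (ThomSpace ν) :=
  inferInstanceAs (TopologicalSpace (Quot (ThomRel ν)))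

/-- The canonical map `D(E) → D(E) / S(E)`. -/
def ThomSpace.ofDisc (ν : E → ℝ) : C(DiscBundle ν, ThomSpace ν) where
  toFun v := Quot.mk _ (Sum.inl v)
  continuous_toFun := continuous_quot_mk.comp continuous_inl

end Thom

/-! ## The space `ℂ^∞` -/

/-- `ℂ^∞ = ⋃ₙ ℂⁿ`: finitely supported sequences of complex numbers. -/
def CInf : Type := ℕ →₀ ℂ

namespace CInf

instance : AddCommGroup CInf := inferInstanceAs (AddCommGroup (ℕ →₀ ℂ))

instance : Module ℂ CInf := inferInstanceAs (Module ℂ (ℕ →₀ ℂ))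

/-- The standard inclusion `ℂⁿ ↪ ℂ^∞`, extension by zero. -/
def incl (n : ℕ) (x : Fin n → ℂ) : CInf :=
  Finsupp.embDomain Fin.valEmbedding (Finsupp.equivFunOnFinite.symm x)

/-- The colimit topology of `ℂ⁰ ⊆ ℂ¹ ⊆ ℂ² ⊆ ⋯`: a set is open iff its preimage in every `ℂⁿ` is. -/
instance : TopologicalSpace CInf := ⨆ n : ℕ, TopologicalSpace.coinduced (incl n) inferInstance

/-- The standard Hermitian norm `√(∑ᵢ |vᵢ|²)` on `ℂ^∞`. -/
def hnorm (v : CInf) : ℝ := Real.sqrt (Finsupp.sum (show ℕ →₀ ℂ from v) fun _ z => ‖z‖ ^ 2)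

theorem hnorm_zero : hnorm 0 = 0 := by
  unfold hnorm
  exact (congrArg Real.sqrt (Finsupp.sum_zero_index (α := ℕ) (M := ℂ))).trans Real.sqrt_zero

end CInf

/-! ## `BU(1)` and its tautological line bundle -/

/-- `BU(1) = ℂP^∞`, the Grassmannian of complex lines in `ℂ^∞`. -/
abbrev BU1 : Type := ℙ ℂ CInf

/-- The quotient topology from `ℂ^∞ ∖ {0}`, which is the colimit topology of the `ℂPⁿ`. -/
instance : TopologicalSpace BU1 :=
  inferInstanceAs (TopologicalSpace (Quotient (projectivizationSetoid ℂ CInf)))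

/-- The total space `V₁ = {(ℓ, v) | v ∈ ℓ} ⊆ BU(1) × ℂ^∞` of the tautological line bundle. -/
def V1 : Type := {p : BU1 × CInf // p.2 ∈ p.1.submodule}

namespace V1

instance : TopologicalSpace V1 :=
  inferInstanceAs (TopologicalSpace {p : BU1 × CInf // p.2 ∈ p.1.submodule})

/-- The fibrewise Hermitian norm of the tautological line bundle. -/
def fiberNorm (v : V1) : ℝ := v.1.2.hnorm

/-- The zero vector in the fibre over `ℓ`. -/
def zero (ℓ : BU1) : V1 := ⟨(ℓ, 0), ℓ.submodule.zero_mem⟩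

theorem continuous_zero : Continuous zero :=
  (continuous_id.prodMk continuous_const).subtype_mk fun ℓ => ℓ.submodule.zero_mem

theorem fiberNorm_zero (ℓ : BU1) : fiberNorm (zero ℓ) ≤ 1 :=
  le_of_eq_of_le CInf.hnorm_zero zero_le_one

/-- The zero section of the tautological line bundle, with values in the disc bundle. -/
def zeroDisc : C(BU1, DiscBundle fiberNorm) where
  toFun ℓ := ⟨zero ℓ, fiberNorm_zero ℓ⟩
  continuous_toFun := continuous_zero.subtype_mk fiberNorm_zero

end V1

/-- The Thom space `BU(1)^{V₁}` of the tautological line bundle. -/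
abbrev ThomV1 : Type := ThomSpace V1.fiberNorm

/-- The zero section `ι : BU(1) → BU(1)^{V₁}`. -/
def zeroSection : C(BU1, ThomV1) := (ThomSpace.ofDisc V1.fiberNorm).comp V1.zeroDisc

end

/-!
The Thom space of the tautological line bundle over `BU(1) = P(ℂ^∞)` is the projective space
`P(ℂ ⊕ ℂ^∞)`, with the zero section corresponding to the inclusion of `P(ℂ^∞)`. As `ℂ ⊕ ℂ^∞ ≅ ℂ^∞`
by prepending a coordinate, this inclusion is the self-map of `P(ℂ^∞)` induced by the right shift,
and that map is homotopic to the identity.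

The homeomorphism sends `([x], v)`, where `v` lies on the line of `x` and `‖v‖ ≤ 1`, to the line
spanned by `(⟪v, x⟫, √(1 - ‖v‖²) x)`; the unit sphere bundle goes to the single line `ℂ ⊕ 0`
(`ThomV1.toLine`). Here `v ↦ ⟪v, ·⟫` is the conjugate-linear isomorphism from the tautological
bundle to its dual, which is the normal bundle of `P(ℂ^∞)` in `P(ℂ ⊕ ℂ^∞)`. The inverse
sends the line of `y = (a, x)` to `([x], (ā / (‖x‖ ‖y‖)) x)`, or to the base point if `x = 0`
(`ThomV1.ofLine`). Continuity of the first map follows because `ℂ^∞ ∖ {0} → BU(1)` is an open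
quotient map and the inner product is continuous on `ℂ^∞ × ℂ^∞`, being pulled back from `ℓ²`.
Continuity of the inverse is delicate only at `x = 0`, because the sphere bundle is not compact; but
by definition of the colimit topology it may be tested on each `ℂⁿ⁺¹`, where the tube lemma for the
compact unit sphere of `ℂⁿ` applies (`ThomV1.continuousAt_ofVec_incl`).

The homotopy is induced by the linear maps `(1 - t) id + t shift`, which are all injective because
the shift has no eigenvectors in `ℂ^∞` (`shiftHomotopy_injective`). Continuity of maps out of
`I × ℂ^∞` is tested on the `I × ℂⁿ`, which is legitimate as `I` is locally compact
(`CInf.continuous_prod_iff`). So the zero section followed by a homeomorphism is homotopic to the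
identity, which makes it a homotopy equivalence.
-/

noncomputable section

open Topology Filter Set ComplexConjugate unitInterval

/-! ### Coordinates on `ℂ^∞` -/

namespace CInf

/-- The `k`-th coordinate of a vector of `ℂ^∞`, as a linear form. -/
def coord (k : ℕ) : CInf →ₗ[ℂ] ℂ := (Finsupp.lapply k : (ℕ →₀ ℂ) →ₗ[ℂ] ℂ)

@[ext]
theorem ext {x y : CInf} (h : ∀ k, coord k x = coord k y) : x = y :=
  Finsupp.ext (α := ℕ) (M := ℂ) h

/-- The left shift `(y₀, y₁, y₂, …) ↦ (y₁, y₂, …)`. -/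
def tail : CInf →ₗ[ℂ] CInf :=
  (Finsupp.lcomapDomain Nat.succ Nat.succ_injective : (ℕ →₀ ℂ) →ₗ[ℂ] (ℕ →₀ ℂ))

/-- The right shift `(x₀, x₁, …) ↦ (0, x₀, x₁, …)`. -/
def shift : CInf →ₗ[ℂ] CInf :=
  (Finsupp.lmapDomain ℂ ℂ Nat.succ : (ℕ →₀ ℂ) →ₗ[ℂ] (ℕ →₀ ℂ))

/-- The identification `ℂ ⊕ ℂ^∞ ≅ ℂ^∞`, `(a, x) ↦ (a, x₀, x₁, …)`. -/
def cons (a : ℂ) (x : CInf) : CInf := (show CInf from Finsupp.single 0 a) + shift x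

@[simp]
theorem coord_tail (k : ℕ) (x : CInf) : coord k (tail x) = coord (k + 1) x := rfl

@[simp]
theorem coord_shift_zero (x : CInf) : coord 0 (shift x) = 0 :=
  Finsupp.mapDomain_of_notMem_range (α := ℕ) (M := ℂ) x 0 (by simp)

@[simp]
theorem coord_shift_succ (k : ℕ) (x : CInf) : coord (k + 1) (shift x) = coord k x :=
  Finsupp.mapDomain_apply (α := ℕ) (M := ℂ) Nat.succ_injective x k

theorem coord_single (k : ℕ) (a : ℂ) :
    coord k (show CInf from Finsupp.single 0 a) = if 0 = k then a else 0 :=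
  Finsupp.single_apply

@[simp]
theorem coord_cons_zero (a : ℂ) (x : CInf) : coord 0 (cons a x) = a := by
  rw [cons, map_add, coord_single]; simp

@[simp]
theorem coord_cons_succ (k : ℕ) (a : ℂ) (x : CInf) : coord (k + 1) (cons a x) = coord k x := by
  rw [cons, map_add, coord_single]; simp

@[simp]
theorem tail_cons (a : ℂ) (x : CInf) : tail (cons a x) = x := by
  ext k; simp

theorem cons_coord_tail (y : CInf) : cons (coord 0 y) (tail y) = y := by
  ext k; cases k <;> simp

theorem smul_cons (c a : ℂ) (x : CInf) : c • cons a x = cons (c * a) (c • x) := by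
  ext k; cases k <;> simp

theorem cons_zero_left (x : CInf) : cons 0 x = shift x := by
  ext k; cases k <;> simp

theorem coord_incl (n k : ℕ) (x : Fin n → ℂ) :
    coord k (incl n x) = if h : k < n then x ⟨k, h⟩ else 0 := by
  split_ifs with h
  · exact Finsupp.embDomain_apply_self Fin.valEmbedding (Finsupp.equivFunOnFinite.symm x) ⟨k, h⟩
  · refine Finsupp.embDomain_of_notMem_range _ _ _ ?_
    rintro ⟨i, rfl⟩
    exact h i.2

/-- The inclusion `ℂⁿ ↪ ℂ^∞` as a linear map. -/
def inclₗ (n : ℕ) : (Fin n → ℂ) →ₗ[ℂ] CInf where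
  toFun := incl n
  map_add' x y := by ext k; simp only [map_add, coord_incl]; split_ifs <;> simp
  map_smul' c x := by
    ext k; simp only [map_smul, coord_incl, RingHom.id_apply]; split_ifs <;> simp

theorem incl_ne_zero {n : ℕ} {x : Fin n → ℂ} (hx : x ≠ 0) : incl n x ≠ 0 := by
  contrapose! hx
  ext i
  simpa [coord_incl] using congrArg (coord i) hx

theorem tail_incl (n : ℕ) (y : Fin (n + 1) → ℂ) : tail (incl (n + 1) y) = incl n (Fin.tail y) := by
  ext k; simp [coord_incl, Fin.tail]

theorem cons_incl (n : ℕ) (a : ℂ) (x : Fin n → ℂ) :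
    cons a (incl n x) = incl (n + 1) (Fin.cons a x) := by
  ext k
  cases k with
  | zero => simp [coord_incl]
  | succ k =>
    simp only [coord_cons_succ, coord_incl, Nat.add_lt_add_iff_right]
    rfl

theorem incl_succ_snoc (n : ℕ) (x : Fin n → ℂ) :
    incl (n + 1) (Fin.snoc (α := fun _ => ℂ) x 0) = incl n x := by
  ext k
  simp only [coord_incl, Fin.snoc]
  split_ifs <;> first | rfl | omega

/-! ### The colimit topology and the `ℓ²` norm -/

theorem isOpen_iff {s : Set CInf} : IsOpen s ↔ ∀ n, IsOpen (incl n ⁻¹' s) := by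
  simp only [isOpen_iSup_iff, isOpen_coinduced]

theorem continuous_iff {Z : Type*} [TopologicalSpace Z] {f : CInf → Z} :
    Continuous f ↔ ∀ n, Continuous (f ∘ incl n) := by
  simp only [continuous_iSup_dom, continuous_coinduced_dom]

theorem continuous_incl (n : ℕ) : Continuous (incl n) := continuous_iff.1 continuous_id n

/-- For locally compact `Y`, the product `Y × ℂ^∞` is the colimit of the `Y × ℂⁿ`: by currying, a
map out of it is a map from `ℂ^∞` to the space `C(Y, Z)` with the compact-open topology. -/
theorem continuous_prod_iff {Y Z : Type*} [TopologicalSpace Y] [LocallyCompactSpace Y]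
    [TopologicalSpace Z] {f : Y × CInf → Z} :
    Continuous f ↔ ∀ n, Continuous fun p : Y × (Fin n → ℂ) => f (p.1, incl n p.2) := by
  refine ⟨fun h n => h.comp (continuous_fst.prodMk ((continuous_incl n).comp continuous_snd)),
    fun h => ?_⟩
  -- Continuity in `Y` alone, needed to form the curried map: `x` lies in some `ℂⁿ`.
  have hY (x : CInf) : Continuous fun y => f (y, x) := by
    obtain ⟨n, u, rfl⟩ : ∃ n u, incl n u = x := by
      have hx : ∃ n, ∀ k, n ≤ k → coord k x = 0 := by
        obtain ⟨n, hn⟩ := (show ℕ →₀ ℂ from x).support.exists_nat_subset_range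
        refine ⟨n, fun k hk => Finsupp.notMem_support_iff.1 fun hk' => ?_⟩
        exact absurd (Finset.mem_range.1 (hn hk')) (by omega)
      obtain ⟨n, hn⟩ := hx
      refine ⟨n, fun i => coord i x, ?_⟩
      ext k
      rw [coord_incl]
      split_ifs with hk
      · rfl
      · exact (hn k (not_lt.1 hk)).symm
    exact (h n).comp (continuous_id.prodMk continuous_const)
  let F : CInf → C(Y, Z) := fun x => ⟨fun y => f (y, x), hY x⟩
  have hF : Continuous F := continuous_iff.2 fun n =>
    (ContinuousMap.curry ⟨fun p : (Fin n → ℂ) × Y => f (p.2, incl n p.1),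
      (h n).comp continuous_swap⟩).continuous
  exact (ContinuousMap.continuous_uncurry_of_continuous ⟨F, hF⟩).comp continuous_swap

theorem continuous_linearMap {E : Type*} [AddCommGroup E] [Module ℂ E] [TopologicalSpace E]
    [IsTopologicalAddGroup E] [ContinuousSMul ℂ E] (f : CInf →ₗ[ℂ] E) : Continuous f :=
  continuous_iff.2 fun n => (f.comp (inclₗ n)).continuous_on_pi

theorem continuous_tail : Continuous tail := by
  refine continuous_iff.2 fun n => ?_
  cases n with
  | zero => exact continuous_of_discreteTopology
  | succ n =>
    simp only [Function.comp_def, tail_incl]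
    exact (continuous_incl n).comp (by unfold Fin.tail; fun_prop)

instance : ContinuousSMul ℂ CInf where
  continuous_smul := continuous_prod_iff.2 fun n =>
    ((continuous_incl n).comp (continuous_fst.smul continuous_snd)).congr fun p =>
      (inclₗ n).map_smul p.1 p.2

theorem continuous_cons : Continuous fun p : ℂ × CInf => cons p.1 p.2 :=
  continuous_prod_iff.2 fun n => by
    simp only [cons_incl]
    exact (continuous_incl (n + 1)).comp 
      (Continuous.finCons (A := fun _ => ℂ) continuous_fst continuous_snd)

theorem hasFiniteSupport_coord (x : CInf) : Function.HasFiniteSupport fun k => ‖coord k x‖ ^ 2 :=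
  (show ℕ →₀ ℂ from x).hasFiniteSupport.subset fun k hk hk' => hk (by
    have : coord k x = 0 := hk'
    simp [this])

/-- The inclusion of `ℂ^∞` into the Hilbert space `ℓ²`. It is continuous, so that the norm and the
inner product of `ℓ²` restrict to continuous functions on `ℂ^∞` and `ℂ^∞ × ℂ^∞`. -/
def toL2 : CInf →ₗ[ℂ] lp (fun _ : ℕ => ℂ) 2 where
  toFun x := ⟨fun k => coord k x, memℓp_gen (by
    simpa using summable_of_hasFiniteSupport (hasFiniteSupport_coord x))⟩
  map_add' x y := by ext k; exact map_add (coord k) x y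
  map_smul' c x := by ext k; exact map_smul (coord k) c x

theorem continuous_toL2 : Continuous toL2 := continuous_linearMap toL2

theorem norm_toL2_sq (x : CInf) : ‖toL2 x‖ ^ 2 = ∑' k, ‖coord k x‖ ^ 2 := by
  have := lp.norm_rpow_eq_tsum (p := 2) (by simp) (toL2 x)
  simp only [ENNReal.toReal_ofNat, Real.rpow_ofNat] at this
  exact this

theorem hnorm_eq (x : CInf) : hnorm x = ‖toL2 x‖ := by
  rw [← Real.sqrt_sq (norm_nonneg (toL2 x)), norm_toL2_sq, hnorm]
  congr 1
  refine (tsum_eq_sum (s := (show ℕ →₀ ℂ from x).support) fun k hk => ?_).symm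
  have : coord k x = 0 := Finsupp.notMem_support_iff.1 hk
  exact (congrArg (‖·‖ ^ 2) this).trans (by simp)

theorem norm_toL2_cons_sq (a : ℂ) (x : CInf) :
    ‖toL2 (cons a x)‖ ^ 2 = ‖a‖ ^ 2 + ‖toL2 x‖ ^ 2 := by
  rw [norm_toL2_sq, norm_toL2_sq,
    (summable_of_hasFiniteSupport (hasFiniteSupport_coord _)).tsum_eq_zero_add]
  simp

theorem toL2_ne_zero {x : CInf} (hx : x ≠ 0) : toL2 x ≠ 0 := by
  contrapose! hx
  ext k
  exact congrArg (fun f : lp (fun _ : ℕ => ℂ) 2 => f k) hx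

end CInf

open CInf

/-! ### The projection onto `BU(1)` and the forward map on discs -/

/-- The projection `ℂ^∞ ∖ {0} → BU(1)` is open, since it is the quotient by a group action; hence
its products with identity maps are still quotient maps. -/
theorem isOpenQuotientMap_mk' :
    IsOpenQuotientMap (Projectivization.mk' ℂ : {x : CInf // x ≠ 0} → BU1) where
  surjective := Quotient.mk''_surjective
  continuous := continuous_quot_mk
  isOpenMap U hU := by
    have hc (c : ℂˣ) : Continuous fun x : {x : CInf // x ≠ 0} =>
        (⟨c • x.1, smul_ne_zero c.ne_zero x.2⟩ : {x : CInf // x ≠ 0}) :=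
      ((continuous_const_smul (c : ℂ)).comp continuous_subtype_val).subtype_mk _
    refine isOpen_coinduced.2 ?_
    convert isOpen_iUnion fun c : ℂˣ => hU.preimage (hc c) using 1
    ext x
    simp only [mem_preimage, mem_iUnion]
    constructor
    · rintro ⟨u, hu, hux⟩
      obtain ⟨c, hc⟩ := (Projectivization.mk_eq_mk_iff ℂ _ _ u.2 x.2).1 hux
      exact ⟨c, by simpa [hc] using hu⟩
    · rintro ⟨c, hc⟩
      exact ⟨_, hc, (Projectivization.mk_eq_mk_iff ℂ _ _ _ x.2).2 ⟨c, rfl⟩⟩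

/-- For `v` in the line spanned by `x`, a spanning vector `(⟪v, x⟫, √(1 - ‖v‖²) x)` of the line in
`ℂ ⊕ ℂ^∞` that corresponds to the point `([x], v)` of the disc bundle. It is linear in `x`, so the
line does not depend on the choice of `x`. At `v = 0` it is the line `[0 : x]`, and for `‖v‖ = 1` it
is the line `ℂ ⊕ 0`. -/
def lineVec (x v : CInf) : CInf :=
  cons (inner ℂ (toL2 v) (toL2 x)) ((√(1 - ‖toL2 v‖ ^ 2) : ℂ) • x)

theorem lineVec_ne_zero {x v : CInf} (hx : x ≠ 0) (hv : v ∈ Submodule.span ℂ {x})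
    (h : ‖toL2 v‖ ≤ 1) : lineVec x v ≠ 0 := by
  intro h0
  obtain ⟨t, rfl⟩ := Submodule.mem_span_singleton.1 hv
  have h1 := congrArg (coord 0) h0
  have h2 := congrArg tail h0
  simp only [lineVec, coord_cons_zero, tail_cons, map_zero, map_smul, inner_smul_left] at h1 h2
  have hx' := toL2_ne_zero hx
  rcases mul_eq_zero.1 h1 with ht | ht
  · have ht : t = 0 := by simpa using ht
    simp [ht, hx] at h2
  · exact hx' (inner_self_eq_zero.1 ht)

theorem lineVec_smul (c : ℂ) (x v : CInf) : lineVec (c • x) v = c • lineVec x v := by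
  rw [lineVec, lineVec, smul_cons, map_smul, inner_smul_right, smul_comm]

theorem continuous_lineVec : Continuous fun p : CInf × CInf => lineVec p.1 p.2 := by
  have h1 := continuous_toL2.comp (continuous_fst (X := CInf) (Y := CInf))
  have h2 := continuous_toL2.comp (continuous_snd (X := CInf) (Y := CInf))
  have h3 : Continuous fun p : CInf × CInf => (√(1 - ‖toL2 p.2‖ ^ 2) : ℂ) :=
    Complex.continuous_ofReal.comp
      (Real.continuous_sqrt.comp (continuous_const.sub (h2.norm.pow 2)))
  exact continuous_cons.comp ((h2.inner h1).prodMk (h3.smul continuous_fst))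

/-- The unit disc bundle of the tautological line bundle. -/
abbrev DiscV1 : Type := DiscBundle V1.fiberNorm

namespace DiscV1

theorem norm_le (d : DiscV1) : ‖toL2 d.1.1.2‖ ≤ 1 := (hnorm_eq _).symm.trans_le d.2

/-- The point `([x], t x)` of the disc bundle. -/
def mk (x : CInf) (hx : x ≠ 0) (t : ℂ) (h : ‖toL2 (t • x)‖ ≤ 1) : DiscV1 :=
  ⟨⟨(Projectivization.mk ℂ x hx, t • x), by
    rw [Projectivization.submodule_mk]
    exact Submodule.smul_mem _ _ (Submodule.mem_span_singleton_self x)⟩, (hnorm_eq _).trans_le h⟩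

theorem ext' {d e : DiscV1} (h1 : d.1.1.1 = e.1.1.1) (h2 : d.1.1.2 = e.1.1.2) : d = e :=
  Subtype.ext (Subtype.ext (Prod.ext h1 h2))

theorem exists_eq_mk (d : DiscV1) : ∃ x hx t h, d = mk x hx t h := by
  obtain ⟨⟨⟨l, v⟩, hv⟩, hd⟩ := d
  induction l using Projectivization.ind with
  | h x hx =>
    rw [Projectivization.submodule_mk] at hv
    obtain ⟨t, rfl⟩ := Submodule.mem_span_singleton.1 hv
    exact ⟨x, hx, t, (hnorm_eq _).symm.trans_le hd, rfl⟩

/-- The map `([x], v) ↦ [⟪v, x⟫ : √(1 - ‖v‖²) x]` from the disc bundle to `BU(1)`. -/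
def toLine (d : DiscV1) : BU1 :=
  Projectivization.mk ℂ (lineVec d.1.1.1.rep d.1.1.2) <|
    lineVec_ne_zero d.1.1.1.rep_nonzero (d.1.1.1.submodule_eq ▸ d.1.2) d.norm_le

theorem toLine_eq (d : DiscV1) {x : CInf} (hx : x ≠ 0) (h : d.1.1.1 = Projectivization.mk ℂ x hx) :
    d.toLine = Projectivization.mk ℂ (lineVec x d.1.1.2) (lineVec_ne_zero hx
      (by have := d.1.2; rwa [h, Projectivization.submodule_mk] at this) d.norm_le) := by
  have h' := (Projectivization.mk_rep d.1.1.1).trans h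
  obtain ⟨c, hc⟩ := (Projectivization.mk_eq_mk_iff' ℂ _ _ _ _).1 h'
  exact (Projectivization.mk_eq_mk_iff' ℂ _ _ _ _).2 ⟨c, by rw [← lineVec_smul, hc]⟩

theorem isInducing_val : IsInducing fun d : DiscV1 => d.1.1 :=
  IsInducing.subtypeVal.comp (g := fun v : V1 => v.1) (f := fun d : DiscV1 => d.1)
    IsInducing.subtypeVal

/-- The pairs `(x, v)` with `x ≠ 0`, `v` in the line spanned by `x`, and `‖v‖ ≤ 1`: the disc bundle
pulled back along `ℂ^∞ ∖ {0} → BU(1)`. -/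
def Cover : Type :=
  {p : {x : CInf // x ≠ 0} × CInf // p.2 ∈ Submodule.span ℂ {p.1.1} ∧ ‖toL2 p.2‖ ≤ 1}

instance : TopologicalSpace Cover :=
  inferInstanceAs (TopologicalSpace {p : {x : CInf // x ≠ 0} × CInf //
    p.2 ∈ Submodule.span ℂ {p.1.1} ∧ ‖toL2 p.2‖ ≤ 1})

/-- The projection of the pulled-back disc bundle onto the disc bundle. -/
def ofCover (p : Cover) : DiscV1 :=
  ⟨⟨(Projectivization.mk' ℂ p.1.1, p.1.2), by
    rw [Projectivization.mk'_eq_mk, Projectivization.submodule_mk]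
    exact p.2.1⟩, (hnorm_eq _).trans_le p.2.2⟩

theorem continuous_cover_val : Continuous fun p : Cover => p.1 := continuous_subtype_val

theorem isOpenQuotientMap_ofCover : IsOpenQuotientMap ofCover where
  surjective d := by
    obtain ⟨x, hx, t, h, rfl⟩ := d.exists_eq_mk
    exact ⟨⟨(⟨x, hx⟩, t • x),
      Submodule.smul_mem _ _ (Submodule.mem_span_singleton_self x), h⟩, rfl⟩
  continuous := isInducing_val.continuous_iff.2 <|
    (isOpenQuotientMap_mk'.prodMap .id).continuous.comp continuous_cover_val
  isOpenMap U hU := by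
    obtain ⟨W, hW, rfl⟩ := isOpen_induced_iff.1 hU
    refine isInducing_val.isOpen_iff.2
      ⟨_, (isOpenQuotientMap_mk'.prodMap .id).isOpenMap W hW, ?_⟩
    ext d
    constructor
    · rintro ⟨p, hp, hpd⟩
      have h1 : Projectivization.mk' ℂ p.1 = d.1.1.1 := congrArg Prod.fst hpd
      have h2 : p.2 = d.1.1.2 := congrArg Prod.snd hpd
      refine ⟨⟨p, ?_, h2 ▸ d.norm_le⟩, hp, ext' h1 h2⟩
      rw [h2, ← Projectivization.submodule_mk p.1.1 p.1.2, ← Projectivization.mk'_eq_mk, h1]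
      exact d.1.2
    · rintro ⟨p, hp, rfl⟩
      exact ⟨p.1, hp, rfl⟩

theorem continuous_toLine : Continuous toLine := by
  rw [← isOpenQuotientMap_ofCover.continuous_comp_iff]
  have h1 : Continuous fun p : Cover => (p.1.1.1, p.1.2) :=
    (continuous_subtype_val.prodMap continuous_id).comp continuous_cover_val
  have h2 (p : Cover) : lineVec p.1.1.1 p.1.2 ≠ 0 := lineVec_ne_zero p.1.1.2 p.2.1 p.2.2
  refine (isOpenQuotientMap_mk'.continuous.comp
    ((continuous_lineVec.comp h1).subtype_mk h2)).congr fun p => ?_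
  exact (toLine_eq (ofCover p) p.1.1.2 rfl).symm

end DiscV1

/-! ### The forward map on the Thom space -/

namespace ThomV1

/-- The base point of the Thom space, the class of the unit sphere bundle. -/
def basePoint : ThomV1 := Quot.mk _ (Sum.inr PUnit.unit)

theorem ofDisc_eq_basePoint {d : DiscV1} (h : ‖toL2 d.1.1.2‖ = 1) :
    ThomSpace.ofDisc _ d = basePoint :=
  Quot.sound (ThomRel.glue d ((hnorm_eq _).trans h))

theorem cons_one_zero_ne_zero : cons 1 0 ≠ 0 := fun h => by
  simpa using congrArg (coord 0) h

/-- The map from the Thom space to `BU(1) = P(ℂ ⊕ ℂ^∞)` which is `[⟪v, x⟫ : √(1 - ‖v‖²) x]` at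
`([x], v)` and sends the base point to the line `ℂ ⊕ 0`. -/
def toLine : ThomV1 → BU1 :=
  Quot.lift (Sum.elim DiscV1.toLine fun _ =>
      Projectivization.mk ℂ (cons 1 0) cons_one_zero_ne_zero) (by
    rintro _ _ ⟨d, hd⟩
    have hd : ‖toL2 d.1.1.2‖ = 1 := (hnorm_eq _).symm.trans hd
    refine (Projectivization.mk_eq_mk_iff' ℂ _ _ _ _).2
      ⟨inner ℂ (toL2 d.1.1.2) (toL2 d.1.1.1.rep), ?_⟩
    simp [lineVec, smul_cons, hd])

theorem continuous_toLine : Continuous toLine :=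
  continuous_quot_lift _ (DiscV1.continuous_toLine.sumElim continuous_const)

theorem toLine_ofDisc (d : DiscV1) : toLine (ThomSpace.ofDisc _ d) = d.toLine := rfl

/-! ### The inverse map -/

/-- The vector of the line through `x = tail y` that the inverse map attaches to `y = (a, x)`,
namely `(ā / (‖x‖ ‖y‖)) x`, has norm `|a| / ‖y‖`. -/
theorem norm_coeff {y : CInf} (h : tail y ≠ 0) :
    ‖toL2 ((conj (coord 0 y) / (‖toL2 (tail y)‖ * ‖toL2 y‖) : ℂ) • tail y)‖ =
      ‖coord 0 y‖ / ‖toL2 y‖ := by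
  have := norm_ne_zero_iff.2 (toL2_ne_zero h)
  rw [map_smul, norm_smul]
  simp only [norm_div, RCLike.norm_conj, norm_mul, Complex.norm_real, norm_norm]
  field_simp

theorem norm_sq_eq (y : CInf) : ‖toL2 y‖ ^ 2 = ‖coord 0 y‖ ^ 2 + ‖toL2 (tail y)‖ ^ 2 := by
  conv_lhs => rw [← cons_coord_tail y]
  exact norm_toL2_cons_sq _ _

theorem norm_coeff_le {y : CInf} (h : tail y ≠ 0) :
    ‖toL2 ((conj (coord 0 y) / (‖toL2 (tail y)‖ * ‖toL2 y‖) : ℂ) • tail y)‖ ≤ 1 := by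
  rw [norm_coeff h]
  refine div_le_one_of_le₀ (abs_le_of_sq_le_sq' ?_ (norm_nonneg _)).2 (norm_nonneg _)
  rw [norm_sq_eq y]
  exact le_add_of_nonneg_right (sq_nonneg _)

open Classical in
/-- The inverse map on vectors: `y = (a, x)` goes to `([x], (ā / (‖x‖ ‖y‖)) x)`, and to the base
point if `x = 0`. -/
def ofVec (y : CInf) : ThomV1 :=
  if h : tail y = 0 then basePoint
  else ThomSpace.ofDisc _ (DiscV1.mk (tail y) h _ (norm_coeff_le h))

theorem ofVec_smul {c : ℂ} (hc : c ≠ 0) (y : CInf) : ofVec (c • y) = ofVec y := by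
  by_cases h : tail y = 0
  · simp [ofVec, h]
  · have h' : tail (c • y) ≠ 0 := by simpa [hc] using h
    rw [ofVec, ofVec, dif_neg h, dif_neg h']
    congr 1
    refine DiscV1.ext' ((Projectivization.mk_eq_mk_iff' ℂ _ _ _ _).2 ⟨c, by simp⟩) ?_
    simp only [DiscV1.mk, map_smul, norm_smul, smul_smul]
    congr 1
    have h1 := norm_ne_zero_iff.2 (toL2_ne_zero h)
    have h2 : ‖toL2 y‖ ≠ 0 := norm_ne_zero_iff.2 (toL2_ne_zero fun h0 => h (by simp [h0]))
    have h3 : (‖c‖ : ℂ) ≠ 0 := by simpa using hc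
    have h4 : conj c * c = (‖c‖ : ℂ) ^ 2 := RCLike.conj_mul c
    simp only [smul_eq_mul, map_mul, Complex.ofReal_mul]
    have h1' : (‖toL2 (tail y)‖ : ℂ) ≠ 0 := by exact_mod_cast h1
    have h2' : (‖toL2 y‖ : ℂ) ≠ 0 := by exact_mod_cast h2
    field_simp
    linear_combination (conj (coord 0 y)) * h4

/-- The inverse `BU(1) → BU(1)^{V₁}` of `ThomV1.toLine`. -/
def ofLine : BU1 → ThomV1 :=
  Projectivization.lift (fun y => ofVec y.1) fun a b t h => by
    have ht : t ≠ 0 := by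
      rintro rfl
      exact a.2 (by simpa using h)
    simp only [h, ofVec_smul ht]

theorem toLine_ofVec {y : CInf} (hy : y ≠ 0) : toLine (ofVec y) = Projectivization.mk ℂ y hy := by
  by_cases h : tail y = 0
  · rw [ofVec, dif_pos h]
    refine ((Projectivization.mk_eq_mk_iff' ℂ _ _ _ _).2 ⟨coord 0 y, ?_⟩).symm
    rw [smul_cons, mul_one, smul_zero, ← h, cons_coord_tail]
  · rw [ofVec, dif_neg h, toLine_ofDisc, DiscV1.toLine_eq _ h rfl]
    have h1 : (‖toL2 (tail y)‖ : ℂ) ≠ 0 := by simpa using toL2_ne_zero h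
    have h2 : (‖toL2 y‖ : ℂ) ≠ 0 := by simpa using toL2_ne_zero hy
    refine (Projectivization.mk_eq_mk_iff' ℂ _ _ _ _).2 ⟨(‖toL2 (tail y)‖ : ℂ) / ‖toL2 y‖, ?_⟩
    conv_lhs => enter [2]; rw [← cons_coord_tail y]
    rw [smul_cons, lineVec]
    congr 1
    · simp only [DiscV1.mk, map_smul, inner_smul_left, inner_self_eq_norm_sq_to_K]
      simp
      field_simp
    · congr 1
      simp only [DiscV1.mk]
      rw [norm_coeff h, ← Complex.ofReal_div]
      congr 1
      have h2 := norm_ne_zero_iff.2 (toL2_ne_zero hy)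
      rw [eq_comm, Real.sqrt_eq_iff_eq_sq]
      · have := norm_sq_eq y
        field_simp
        linarith
      · rw [sub_nonneg, sq_le_one_iff₀ (by positivity), ← norm_coeff h]
        exact norm_coeff_le h
      · positivity

theorem ofVec_lineVec {x : CInf} (hx : x ≠ 0) (t : ℂ) (h : ‖toL2 (t • x)‖ ≤ 1) :
    ofVec (lineVec x (t • x)) = ThomSpace.ofDisc _ (DiscV1.mk x hx t h) := by
  have hs : tail (lineVec x (t • x)) = (√(1 - ‖toL2 (t • x)‖ ^ 2) : ℂ) • x := tail_cons _ _
  have hx' := norm_ne_zero_iff.2 (toL2_ne_zero hx)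
  rcases h.eq_or_lt with h1 | h1
  · have h0 : tail (lineVec x (t • x)) = 0 := by rw [hs, h1]; simp
    rw [ofVec, dif_pos h0]
    exact (ofDisc_eq_basePoint (d := DiscV1.mk x hx t h) h1).symm
  · have hpos : 0 < 1 - ‖toL2 (t • x)‖ ^ 2 := by
      rw [sub_pos]; exact pow_lt_one₀ (norm_nonneg _) h1 two_ne_zero
    set s : ℝ := √(1 - ‖toL2 (t • x)‖ ^ 2) with hsdef
    have hs0 : 0 < s := Real.sqrt_pos.2 hpos
    have hs2 : s ^ 2 = 1 - ‖toL2 (t • x)‖ ^ 2 := Real.sq_sqrt hpos.le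
    have ht : tail (lineVec x (t • x)) ≠ 0 := by
      rw [hs]
      exact smul_ne_zero (by exact_mod_cast hs0.ne') hx
    have h0 : coord 0 (lineVec x (t • x)) = conj t * (‖toL2 x‖ : ℂ) ^ 2 := by
      rw [lineVec, coord_cons_zero, map_smul, inner_smul_left, inner_self_eq_norm_sq_to_K]
      rfl
    have hn : ‖toL2 (lineVec x (t • x))‖ = ‖toL2 x‖ := by
      refine (sq_eq_sq₀ (norm_nonneg _) (norm_nonneg _)).1 ?_
      rw [norm_sq_eq, h0, hs, map_smul, norm_smul, Complex.norm_real, Real.norm_of_nonneg hs0.le,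
        mul_pow s, hs2, map_smul, norm_smul, norm_mul, RCLike.norm_conj, norm_pow,
        Complex.norm_real, norm_norm]
      ring
    rw [ofVec, dif_neg ht]
    congr 1
    refine DiscV1.ext' ((Projectivization.mk_eq_mk_iff' ℂ _ _ _ _).2 ⟨s, hs.symm⟩) ?_
    simp only [DiscV1.mk]
    rw [hn, h0, hs, smul_smul]
    congr 1
    have hsc : (s : ℂ) ≠ 0 := by exact_mod_cast hs0.ne'
    have hxc : (‖toL2 x‖ : ℂ) ≠ 0 := by exact_mod_cast hx'
    rw [map_smul, norm_smul, Complex.norm_real, Real.norm_of_nonneg hs0.le]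
    simp only [map_mul, map_pow, Complex.conj_conj, Complex.conj_ofReal, Complex.ofReal_mul]
    field_simp

theorem ofLine_toLine (z : ThomV1) : ofLine (toLine z) = z := by
  obtain ⟨d | ⟨⟩, rfl⟩ := Quot.exists_rep z
  · obtain ⟨x, hx, t, h, rfl⟩ := DiscV1.exists_eq_mk d
    refine (congrArg ofLine (DiscV1.toLine_eq _ hx rfl)).trans ?_
    exact ofVec_lineVec hx t h
  · exact dif_pos (tail_cons _ _)

theorem toLine_ofLine (l : BU1) : toLine (ofLine l) = l := by
  induction l using Projectivization.ind with
  | h y hy => exact toLine_ofVec hy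

end ThomV1

/-! ### Continuity of the inverse map -/

namespace ThomV1

theorem isOpen_tail_ne_zero : IsOpen {y : CInf | tail y ≠ 0} := by
  have : Continuous fun y : CInf => ‖toL2 (tail y)‖ := (continuous_toL2.comp continuous_tail).norm
  convert (isOpen_ne (x := (0 : ℝ))).preimage this using 1
  ext y
  exact ⟨fun h => norm_ne_zero_iff.2 (toL2_ne_zero h), fun h h0 => h (by simp [h0])⟩

theorem continuousAt_ofVec {y : CInf} (h : tail y ≠ 0) : ContinuousAt ofVec y := by
  refine (continuousOn_iff_continuous_domRestrict.2 ?_).continuousAt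
    (isOpen_tail_ne_zero.mem_nhds h)
  have hd : Continuous fun y : {y : CInf | tail y ≠ 0} =>
      DiscV1.mk (tail y.1) y.2 _ (norm_coeff_le y.2) := by
    refine DiscV1.isInducing_val.continuous_iff.2 (.prodMk ?_ ?_)
    · exact isOpenQuotientMap_mk'.continuous.comp
        ((continuous_tail.comp continuous_subtype_val).subtype_mk fun y => y.2)
    · have h1 := (continuous_tail.comp (continuous_subtype_val (p := fun y => tail y ≠ 0)))
      have h2 := (continuous_toL2.comp h1).norm
      have h3 := (continuous_toL2.comp (continuous_subtype_val (p := fun y => tail y ≠ 0))).norm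
      have h4 := ((continuous_linearMap (coord 0)).comp
        (continuous_subtype_val (p := fun y => tail y ≠ 0)))
      refine (((Complex.continuous_conj.comp h4).div ((Complex.continuous_ofReal.comp h2).mul
        (Complex.continuous_ofReal.comp h3)) fun y => ?_).smul h1).congr fun _ => rfl
      have h5 := norm_ne_zero_iff.2 (toL2_ne_zero y.2)
      have h6 := norm_ne_zero_iff.2 (toL2_ne_zero (x := y.1) fun h => y.2 (by simp [h]))
      exact mul_ne_zero (Complex.ofReal_ne_zero.2 h5) (Complex.ofReal_ne_zero.2 h6)
  refine ((ThomSpace.ofDisc V1.fiberNorm).continuous.comp hd).congr fun y => ?_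
  rw [domRestrict_apply, ofVec, dif_neg (show ¬ tail y.1 = 0 from y.2)]
  rfl

/-- The coefficient in `ThomV1.collar`: in terms of `x = s u`, the scalar `ā / (‖x‖ ‖(a, x)‖)` of
the inverse map times `s`, which still makes sense at `s = 0`. -/
def collarCoeff {n : ℕ} (p : ℂ × ℝ) (u : Metric.sphere (0 : Fin n → ℂ) 1) : ℂ :=
  conj p.1 / (‖toL2 (incl n u)‖ * √(‖p.1‖ ^ 2 + p.2 ^ 2 * ‖toL2 (incl n u)‖ ^ 2) : ℂ)

/-- The lift of the inverse map to `BU(1) × ℂ^∞` in polar coordinates: the value at `(a, s u)`, for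
`u` in the unit sphere of `ℂⁿ`. Unlike `ofVec`, it is continuous at `s = 0` as long as `a ≠ 0`. The
sphere is that of the sup norm, of which only compactness and `0 ∉ S` matter. -/
def collar {n : ℕ} (p : ℂ × ℝ) (u : Metric.sphere (0 : Fin n → ℂ) 1) : BU1 × CInf :=
  (Projectivization.mk ℂ (incl n u) (incl_ne_zero (ne_zero_of_mem_unit_sphere u)),
    collarCoeff p u • incl n u)

theorem continuous_incl_sphere (n : ℕ) :
    Continuous fun u : Metric.sphere (0 : Fin n → ℂ) 1 => incl n u :=
  (continuous_incl n).comp continuous_subtype_val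

theorem continuousAt_collarCoeff {n : ℕ} {p : ℂ × ℝ} (hp : p.1 ≠ 0)
    (u : Metric.sphere (0 : Fin n → ℂ) 1) :
    ContinuousAt (fun q : (ℂ × ℝ) × Metric.sphere (0 : Fin n → ℂ) 1 => collarCoeff q.1 q.2)
      (p, u) := by
  have h2 : Continuous fun u : Metric.sphere (0 : Fin n → ℂ) 1 => ‖toL2 (incl n u)‖ :=
    (continuous_toL2.comp (continuous_incl_sphere n)).norm
  refine ContinuousAt.div (by fun_prop) (Continuous.continuousAt ?_) ?_
  · have h3 := h2.comp (continuous_snd (X := ℂ × ℝ))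
    refine (Complex.continuous_ofReal.comp h3).mul (Complex.continuous_ofReal.comp ?_)
    refine Real.continuous_sqrt.comp (.add (by fun_prop) (.mul (by fun_prop) (h3.pow 2)))
  · have h5 := norm_pos_iff.2 (toL2_ne_zero (incl_ne_zero (ne_zero_of_mem_unit_sphere u)))
    have h6 : 0 < ‖p.1‖ := norm_pos_iff.2 hp
    have h7 : 0 < √(‖p.1‖ ^ 2 + p.2 ^ 2 * ‖toL2 (incl n u)‖ ^ 2) := by positivity
    exact mul_ne_zero (Complex.ofReal_ne_zero.2 h5.ne') (Complex.ofReal_ne_zero.2 h7.ne')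

theorem continuousAt_collar {n : ℕ} {p : ℂ × ℝ} (hp : p.1 ≠ 0)
    (u : Metric.sphere (0 : Fin n → ℂ) 1) :
    ContinuousAt (fun q : (ℂ × ℝ) × Metric.sphere (0 : Fin n → ℂ) 1 => collar q.1 q.2) (p, u) := by
  have h1 : Continuous fun q : (ℂ × ℝ) × Metric.sphere (0 : Fin n → ℂ) 1 => incl n q.2 :=
    (continuous_incl_sphere n).comp continuous_snd
  have h2 := isOpenQuotientMap_mk'.continuous.comp
    (h1.subtype_mk fun q => incl_ne_zero (ne_zero_of_mem_unit_sphere q.2))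
  exact h2.continuousAt.prodMk ((continuousAt_collarCoeff hp u).smul h1.continuousAt)

theorem exists_eq_collar {n : ℕ} (y : Fin (n + 1) → ℂ) (h : tail (incl (n + 1) y) ≠ 0) :
    ∃ u, (DiscV1.mk (tail (incl (n + 1) y)) h _ (norm_coeff_le h)).1.1 =
      collar (n := n) (y 0, ‖Fin.tail y‖) u := by
  have hy : Fin.tail y ≠ 0 := fun h0 => h (by
    rw [tail_incl, h0]; exact (inclₗ n).map_zero)
  have hs := norm_ne_zero_iff.2 hy
  set s := ‖Fin.tail y‖ with hsdef
  have hsc : (s : ℂ) ≠ 0 := by exact_mod_cast hs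
  let u : Metric.sphere (0 : Fin n → ℂ) 1 := ⟨(s : ℂ)⁻¹ • Fin.tail y, by
    rw [mem_sphere_zero_iff_norm, norm_smul, norm_inv, Complex.norm_real, hsdef, norm_norm]
    exact inv_mul_cancel₀ hs⟩
  have hu : tail (incl (n + 1) y) = (s : ℂ) • incl n u := by
    refine Eq.trans ?_ ((inclₗ n).map_smul (s : ℂ) u)
    rw [tail_incl, smul_inv_smul₀ hsc]
    rfl
  have hun := norm_ne_zero_iff.2 (toL2_ne_zero (incl_ne_zero (ne_zero_of_mem_unit_sphere u)))
  have h0 : coord 0 (incl (n + 1) y) = y 0 := by simp [coord_incl]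
  have hs0 : 0 ≤ s := norm_nonneg _
  have hy2 : ‖toL2 (incl (n + 1) y)‖ = √(‖y 0‖ ^ 2 + s ^ 2 * ‖toL2 (incl n u)‖ ^ 2) := by
    rw [← Real.sqrt_sq (norm_nonneg (toL2 (incl (n + 1) y))), norm_sq_eq, h0, hu, map_smul,
      norm_smul, Complex.norm_real, Real.norm_of_nonneg hs0, mul_pow]
  refine ⟨u, Prod.ext ((Projectivization.mk_eq_mk_iff' ℂ _ _ _ _).2 ⟨s, hu.symm⟩) ?_⟩
  simp only [DiscV1.mk, collar, collarCoeff]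
  rw [← hy2, h0, hu, smul_smul, map_smul, norm_smul, Complex.norm_real, Real.norm_of_nonneg hs0]
  congr 1
  push_cast
  field_simp

/-- The inverse map is continuous on each `ℂⁿ⁺¹ ∖ {0}`. At a vector `(a, 0)` this rests on
compactness of the unit sphere of `ℂⁿ`: an open neighbourhood of the base point contains the collar
at `s = 0`, and hence, by the tube lemma, the collar for all parameters near `(a, 0)`. -/
theorem continuousAt_ofVec_incl {n : ℕ} {y : Fin (n + 1) → ℂ} (hy : y ≠ 0) :
    ContinuousAt (ofVec ∘ incl (n + 1)) y := by
  by_cases h : tail (incl (n + 1) y) = 0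
  swap
  · exact (continuousAt_ofVec h).comp (continuous_incl _).continuousAt
  have ht : Fin.tail y = 0 := by
    rw [tail_incl] at h
    by_contra h0
    exact incl_ne_zero h0 h
  have hy0 : y 0 ≠ 0 := fun h0 => hy (by
    rw [← Fin.cons_self_tail y, h0, ht]
    ext i; refine Fin.cases ?_ (fun i => ?_) i <;> simp)
  rw [ContinuousAt, Function.comp_apply, ofVec, dif_pos h]
  refine fun O hO => mem_map.2 ?_
  obtain ⟨O', hO', hO'o, hbO'⟩ := mem_nhds_iff.1 hO
  obtain ⟨W, hW, hWO⟩ := DiscV1.isInducing_val.isOpen_iff.1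
    (hO'o.preimage (ThomSpace.ofDisc V1.fiberNorm).continuous)
  have hev : ∀ᶠ p : ℂ × ℝ in 𝓝 (y 0, 0),
      ∀ u ∈ (univ : Set (Metric.sphere (0 : Fin n → ℂ) 1)), collar p u ∈ W := by
    refine isCompact_univ.eventually_forall_of_forall_eventually fun u _ => ?_
    refine (continuousAt_collar (p := (y 0, 0)) hy0 u).eventually_mem (hW.mem_nhds ?_)
    have hu0 := incl_ne_zero (ne_zero_of_mem_unit_sphere u)
    -- At `s = 0` the collar consists of unit vectors, which the Thom space collapses.
    have hun := norm_ne_zero_iff.2 (toL2_ne_zero hu0)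
    have hy0' : ‖y 0‖ ≠ 0 := norm_ne_zero_iff.2 hy0
    set t : ℂ := collarCoeff (y 0, 0) u with ht'
    have hn : ‖toL2 (t • incl n u)‖ = 1 := by
      rw [map_smul, norm_smul, ht', collarCoeff]
      simp [Real.sqrt_sq]
      field_simp
    have hmem : DiscV1.mk (incl n u) hu0 t hn.le ∈ ThomSpace.ofDisc V1.fiberNorm ⁻¹' O' := by
      have := ofDisc_eq_basePoint (d := DiscV1.mk (incl n u) hu0 t hn.le) hn
      rw [mem_preimage, this]
      exact hbO'
    rw [← hWO] at hmem
    exact hmem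
  have hc : Continuous fun y : Fin (n + 1) → ℂ => (y 0, ‖Fin.tail y‖) := by
    unfold Fin.tail; fun_prop
  have hc' := hc.tendsto y
  rw [ht, norm_zero] at hc'
  filter_upwards [hc'.eventually hev] with z hz
  refine hO' ?_
  by_cases hz0 : tail (incl (n + 1) z) = 0
  · rw [Function.comp_apply, ofVec, dif_pos hz0]
    exact hbO'
  · rw [Function.comp_apply, ofVec, dif_neg hz0]
    obtain ⟨u, hu⟩ := exists_eq_collar z hz0
    have hmem := hz u trivial
    rw [← hu] at hmem
    change _ ∈ ThomSpace.ofDisc V1.fiberNorm ⁻¹' O'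
    rw [← hWO]
    exact hmem

/-- The inverse map is continuous: `ℂ^∞ ∖ {0}` is open in `ℂ^∞`, so openness of preimages can be
tested on each `ℂⁿ`. -/
theorem continuous_ofLine : Continuous ofLine := by
  rw [← isOpenQuotientMap_mk'.continuous_comp_iff]
  refine continuous_def.2 fun O hO => isOpen_induced_iff.2 ⟨ofVec ⁻¹' O ∩ {y | y ≠ 0}, ?_, ?_⟩
  · refine isOpen_iff.2 fun n => isOpen_iff_mem_nhds.2 fun y hy => ?_
    cases n with
    | zero =>
      exact (hy.2 ((congrArg (incl 0) (Subsingleton.elim y 0)).trans (inclₗ 0).map_zero)).elim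
    | succ n =>
      have hy0 : y ≠ 0 := fun h => hy.2 (h ▸ (inclₗ _).map_zero)
      filter_upwards [(continuousAt_ofVec_incl hy0).preimage_mem_nhds (hO.mem_nhds hy.1),
        isOpen_ne.mem_nhds hy0] with z hz hz0
      exact ⟨hz, incl_ne_zero hz0⟩
  · ext y
    exact ⟨fun h => h.1, fun h => ⟨h, y.2⟩⟩

/-- The homeomorphism `BU(1)^{V₁} ≅ P(ℂ ⊕ ℂ^∞) = BU(1)`. -/
def homeo : ThomV1 ≃ₜ BU1 where
  toFun := toLine
  invFun := ofLine
  left_inv := ofLine_toLine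
  right_inv := toLine_ofLine
  continuous_toFun := continuous_toLine
  continuous_invFun := continuous_ofLine

end ThomV1

/-! ### The shift is homotopic to the identity -/

/-- The linear interpolation `(1 - t) x + t (0, x)` between the identity and the right shift of
`ℂ^∞`. -/
def shiftHomotopy (t : ℝ) : CInf →ₗ[ℂ] CInf :=
  ((1 - t : ℝ) : ℂ) • LinearMap.id + (t : ℂ) • shift

/-- The right shift has no eigenvectors: comparing coordinates in `(1 - t) x + t (0, x) = 0` from
the lowest one upwards gives `x = 0`. -/
theorem shiftHomotopy_injective (t : ℝ) : Function.Injective (shiftHomotopy t) := by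
  rw [← LinearMap.ker_eq_bot, LinearMap.ker_eq_bot']
  intro x hx
  have h0 : (1 - t : ℂ) * coord 0 x = 0 := by
    simpa [shiftHomotopy] using congrArg (coord 0) hx
  have hs (k : ℕ) : (1 - t : ℂ) * coord (k + 1) x + t * coord k x = 0 := by
    simpa [shiftHomotopy] using congrArg (coord (k + 1)) hx
  by_cases ht : (1 - t : ℂ) = 0
  -- For `t = 1` the coordinate `k + 1` of the relation reads `x k = 0`.
  · ext k
    have h1 : (t : ℂ) = 1 := (sub_eq_zero.1 ht).symm
    simpa [ht, h1] using hs k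
  · ext k
    induction k with
    | zero => simpa [ht] using h0
    | succ k ih => simpa [ht, ih] using hs k

theorem continuous_shiftHomotopy : Continuous fun p : I × CInf => shiftHomotopy p.1 p.2 := by
  refine continuous_prod_iff.2 fun n => ?_
  have h (t : ℝ) (x : Fin n → ℂ) : incl (n + 1) (((1 - t : ℝ) : ℂ) •
      Fin.snoc (α := fun _ => ℂ) x 0 + (t : ℂ) • Fin.cons (α := fun _ => ℂ) 0 x) =
      shiftHomotopy t (incl n x) := by
    refine ((inclₗ (n + 1)).map_add _ _).trans ?_
    rw [map_smul, map_smul]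
    change _ • incl (n + 1) _ + _ • incl (n + 1) _ = _
    rw [incl_succ_snoc, ← cons_incl, cons_zero_left]
    rfl
  simp only [← h]
  refine (continuous_incl (n + 1)).comp ?_
  have h1 : Continuous fun p : I × (Fin n → ℂ) => Fin.snoc (α := fun _ => ℂ) p.2 0 :=
    Continuous.finSnoc (A := fun _ => ℂ) continuous_snd continuous_const
  have h2 : Continuous fun p : I × (Fin n → ℂ) => Fin.cons (α := fun _ => ℂ) 0 p.2 :=
    Continuous.finCons (A := fun _ => ℂ) continuous_const continuous_snd
  have h3 : Continuous fun p : I × (Fin n → ℂ) => ((p.1 : ℝ) : ℂ) := by fun_prop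
  have h4 : Continuous fun p : I × (Fin n → ℂ) => ((1 - p.1 : ℝ) : ℂ) := by fun_prop
  exact (h4.smul h1).add (h3.smul h2)

/-- The homotopy of maps `BU(1) → BU(1)` induced by `shiftHomotopy`. -/
def lineHomotopy (p : I × BU1) : BU1 :=
  Projectivization.map (shiftHomotopy p.1) (shiftHomotopy_injective p.1) p.2

theorem continuous_lineHomotopy : Continuous lineHomotopy := by
  rw [← (IsOpenQuotientMap.id.prodMap isOpenQuotientMap_mk').continuous_comp_iff]
  have h := continuous_shiftHomotopy.comp
    ((continuous_id (X := I)).prodMap (continuous_subtype_val (p := fun x : CInf => x ≠ 0)))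
  have hne (p : I × {x : CInf // x ≠ 0}) : shiftHomotopy p.1 p.2.1 ≠ 0 :=
    (map_ne_zero_iff _ (shiftHomotopy_injective p.1)).2 p.2.2
  exact (isOpenQuotientMap_mk'.continuous.comp (h.subtype_mk hne)).congr fun _ => rfl

theorem lineHomotopy_one (l : BU1) : lineHomotopy (1, l) = ThomV1.homeo (zeroSection l) := by
  induction l using Projectivization.ind with
  | h x hx =>
    refine Eq.trans ?_ (DiscV1.toLine_eq (V1.zeroDisc (Projectivization.mk ℂ x hx)) hx rfl).symm
    refine (Projectivization.mk_eq_mk_iff' ℂ _ _ _ _).2 ⟨1, ?_⟩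
    have hz : (V1.zeroDisc (Projectivization.mk ℂ x hx)).1.1.2 = 0 := rfl
    rw [hz, lineVec, one_smul]
    simp [shiftHomotopy, cons_zero_left]

/-- The identity of `BU(1)` is homotopic to the zero section followed by `ThomV1.homeo`. -/
def zeroSectionHomotopy :
    (ContinuousMap.id BU1).Homotopy (ThomV1.homeo.toHomotopyEquiv.toFun.comp zeroSection) where
  toFun := lineHomotopy
  continuous_toFun := continuous_lineHomotopy
  map_zero_left l := by
    have : shiftHomotopy ((0 : I) : ℝ) = LinearMap.id := by simp [shiftHomotopy]
    induction l using Projectivization.ind with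
    | h x hx =>
      exact (Projectivization.mk_eq_mk_iff' ℂ _ _ _ _).2 ⟨1, by
        rw [one_smul]; exact (LinearMap.congr_fun this x).symm⟩
  map_one_left := lineHomotopy_one

end

theorem mainTheorem7 : ∃ e : BU1 ≃ₕ ThomV1, e.toFun = zeroSection := by
  have h : (ThomV1.homeo.toHomotopyEquiv.toFun.comp zeroSection).Homotopic (.id BU1) :=
    .symm ⟨zeroSectionHomotopy⟩
  refine ⟨⟨zeroSection, ThomV1.homeo.toHomotopyEquiv.toFun, h, ?_⟩, rfl⟩
  have h' := ((ContinuousMap.Homotopic.refl ThomV1.homeo.toHomotopyEquiv.invFun).comp h).comp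
    (ContinuousMap.Homotopic.refl ThomV1.homeo.toHomotopyEquiv.toFun)
  convert h' using 1
  · ext z
    exact (ThomV1.homeo.symm_apply_apply _).symm
  · ext z
    exact (ThomV1.homeo.symm_apply_apply _).symm
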